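/- Let $\mathcal K$ be a (strict) 2-category. **Operators, relative monads.** For cospans $F\colon X\to Z\leftarrow Y\colon G$ and $F'\colon X\to Z'\leftarrow Y\colon G'$ in $\mathcal K$, an *operator* $(-)^\#\colon[F,G]\to[F',G']$ is a family of functions $\mathcal K(O,Z)(FA,GB)\to\mathcal K(O,Z')(F'A,G'B)$, for all 1-cells $A\colon O\to X$, $B\colon O\to Y$, with $(fP)^\#=f^\#P$, $(f\cdot F\alpha)^\#=f^\#\cdot F'\alpha$ and $(G\beta\cdot f)^\#=G'\beta\cdot f^\#$ for all 1-cells $P\colon O'\to O$ and 2-cells $\alpha\colon A'\to A$, $\beta\colon B\to B'$. A *relative monad* $(X,I,T)$ consists of 1-cells $I,T\colon X_0\to X$, an operator $(-)^\dagger\colon[I,T]\to[T,T]$ and a 2-cell $t\colon I\to T$ with $k^\dagger\cdot tA=k$, $t^\dagger=1_T$ and $(l^\dagger\cdot k)^\dagger=l^\dagger\cdot k^\dagger$ for all $k\colon IA\to TB$, $l\colon IB\to TC$. A *monad $(S,S_0)$ compatible with $I$* consists of monads $(S,m,s)$ on $X$ and $(S_0,m_0,s_0)$ on $X_0$ with $SI=IS_0$,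 $mI=Im_0$ and $sI=Is_0$. **Relative distributive laws.** A *relative distributive law* of $T$ over $(S,S_0)$ is a 2-cell $d\colon ST\to TS_0$ with $d\cdot mT=Tm_0\cdot dS_0\cdot Sd$, $d\cdot sT=Ts_0$, $d\cdot St=tS_0$, and $dB\cdot Sf^\dagger=(dB\cdot Sf)^\dagger\cdot dA$ for every 2-cell $f\colon IA\to TB$. **Modules.** A *$K$-indexed relative right $T$-module* is a 1-cell $M\colon X_0\to K$ with an operator $(-)_m\colon[I,T]\to[M,M]$ such that $t_m=1_M$ and $(k^\dagger\cdot h)_m=k_m\cdot h_m$ for all $h\colon IA\to TB$, $k\colon IB\to TC$; a morphism $(M,(-)_m)\to(N,(-)_n)$ is a 2-cell $g\colon M\to N$ with $gB\cdot h_m=h_n\cdot gA$ for all $h\colon IA\to TB$. With postcomposition these form a 2-functor $\mathrm{Mod}_T(-)\colon\mathcal K\to\mathbf{Cat}$. Let $U^*\colon\mathcal K(X,-)\to\mathrm{Mod}_T(-)$ be $M\mapsto(MT,M(-)^\dagger)$, let $J^*\colon\mathrm{Mod}_T(-)\to\mathcal K(X_0,-)$ be the forgetful 2-natural transformation, and let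 $t\colon(-\circ I)\to J^*U^*$ be the modification with components $Mt\colon MI\to MT$. **Liftings.** A *lifting of $S$ to the relative right modules of $T$* is a monad $\tilde S=(\tilde S,\tilde m,\tilde s)$ on $\mathrm{Mod}_T(-)$ (a 2-natural endo-transformation with modifications $\tilde m,\tilde s$) together with a modification $d^*\colon U^*(-\circ S)\to\tilde SU^*$, with components $d^*_M\colon(MST,\,MS(-)^\dagger)\to\tilde S(MT,\,M(-)^\dagger)$, such that: 1. $J^*\tilde S=(-\circ S_0)J^*$, $J^*\tilde m=(-\circ m_0)J^*$ and $J^*\tilde s=(-\circ s_0)J^*$; 2. $d^*$ respects the units and multiplications of $-\circ S$ and $\tilde S$: $d^*\cdot U^*(-\circ s)=\tilde sU^*$ and $d^*\cdot U^*(-\circ m)=\tilde mU^*\cdot\tilde Sd^*\cdot d^*(-\circ S)$; 3. $J^*d^*_M\cdot MSt=MtS_0$ for every $M\colon X\to K$; 4. $f_{\tilde Sm}=(f_{\tilde ST}\cdot tS_0A)_m$ for every module $(M,(-)_m)$ and every $f\colon IA\to TB$, where $(-)_{\tilde Sm}$ and $(-)_{\tilde ST}$ are the structure operators of $\tilde S(M,(-)_m)$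 and $\tilde S(T,(-)^\dagger)$. **Theorem.** Let $(X,I,T)$ be a relative monad in $\mathcal K$ and $(S,S_0)$ a monad compatible with $I$. Relative distributive laws of $T$ over $(S,S_0)$ are equivalent to liftings of $S$ to the relative right modules of $T$: there is a bijection between the two, under which a law $d$ corresponds to the lifting $(\tilde S,d^*)$ with $J^*d^*_M=Md\colon MST\to MTS_0$ for every $M\colon X\to K$ and $f_{\tilde Sm}=(dB\cdot Sf)_m\colon MS_0A\to MS_0B$ for every module $(M,(-)_m)$ and every $f\colon IA\to TB$. -/

import Mathlib

open CategoryTheory Bicategory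

universe w v u w₁ v₁ w₂ v₂ w₃ v₃

namespace RelMnd

/-! Conventions.  A 2-category is a Mathlib bicategory `K` with `Bicategory.Strict K`.
Composition is written in diagrammatic order: the 1-cell `G ∘ F` is `F ≫ G`, the 2-cell `G α` is
`α ▷ G`, and the 2-cell `f P` (restriction along `P`) is `P ◁ f`.  Associators, unitors and
`eqToHom` are the identity 2-cells between equal composites; they only re-bracket. -/

section TwoCategory

variable {K : Type u} [Bicategory.{w, v} K]

/-- An operator `[F, G] → [F', G']` between the cospans `(F, G)` and `(F', G')`: functions
`K(O, Z)(F A, G B) → K(O, Z')(F' A, G' B)` for all spans `(A, B)`, with indexing, left and right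
naturality. -/
@[ext]
structure Operator {X Y Z Z' : K} (F : X ⟶ Z) (G : Y ⟶ Z) (F' : X ⟶ Z') (G' : Y ⟶ Z') where
  app : ∀ {O : K} {A : O ⟶ X} {B : O ⟶ Y}, (A ≫ F ⟶ B ≫ G) → (A ≫ F' ⟶ B ≫ G')
  indexing : ∀ {O' O : K} (P : O' ⟶ O) {A : O ⟶ X} {B : O ⟶ Y} (f : A ≫ F ⟶ B ≫ G),
    app ((α_ P A F).hom ≫ P ◁ f ≫ (α_ P B G).inv) =
      (α_ P A F').hom ≫ P ◁ app f ≫ (α_ P B G').inv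
  left_naturality : ∀ {O : K} {A' A : O ⟶ X} {B : O ⟶ Y} (a : A' ⟶ A) (f : A ≫ F ⟶ B ≫ G),
    app (a ▷ F ≫ f) = a ▷ F' ≫ app f
  right_naturality : ∀ {O : K} {A : O ⟶ X} {B B' : O ⟶ Y} (f : A ≫ F ⟶ B ≫ G) (b : B ⟶ B'),
    app (f ≫ b ▷ G) = app f ≫ b ▷ G'

/-- A relative monad `(X, I, T)` on the 1-cell `I : X₀ ⟶ X`; `carrier` is the 1-cell `T`. -/
structure RelMonad {X₀ X : K} (I : X₀ ⟶ X) where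
  carrier : X₀ ⟶ X
  /-- the extension operator `(-)†` -/
  ext : Operator I carrier carrier carrier
  unit : I ⟶ carrier
  left_unit : ∀ {O : K} {A B : O ⟶ X₀} (k : A ≫ I ⟶ B ≫ carrier),
    A ◁ unit ≫ ext.app k = k
  right_unit : ext.app ((λ_ I).hom ≫ unit ≫ (λ_ carrier).inv) = 𝟙 (𝟙 X₀ ≫ carrier)
  assoc : ∀ {O : K} {A B C : O ⟶ X₀} (k : A ≫ I ⟶ B ≫ carrier) (l : B ≫ I ⟶ C ≫ carrier),
    ext.app (k ≫ ext.app l) = ext.app k ≫ ext.app l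

/-- A monad in a 2-category on the object `X`; `carrier` is the underlying 1-cell. -/
structure MonadIn (X : K) where
  carrier : X ⟶ X
  mul : carrier ≫ carrier ⟶ carrier
  unit : 𝟙 X ⟶ carrier
  assoc : mul ▷ carrier ≫ mul = (α_ carrier carrier carrier).hom ≫ carrier ◁ mul ≫ mul
  unit_left : unit ▷ carrier ≫ mul = (λ_ carrier).hom
  unit_right : carrier ◁ unit ≫ mul = (ρ_ carrier).hom

/-- A monad `(S, S₀)` compatible with `I : X₀ ⟶ X`: monads `S` on `X` and `S₀` on `X₀` with
`S I = I S₀`, `m I = I m₀` and `s I = I s₀`. -/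
structure CompatibleMonad {X₀ X : K} (I : X₀ ⟶ X) where
  S : MonadIn X
  S₀ : MonadIn X₀
  comm : I ≫ S.carrier = S₀.carrier ≫ I
  comm_mul : I ◁ S.mul ≫ eqToHom comm =
    (α_ I S.carrier S.carrier).inv ≫ eqToHom comm ▷ S.carrier ≫
      (α_ S₀.carrier I S.carrier).hom ≫ S₀.carrier ◁ eqToHom comm ≫
      (α_ S₀.carrier S₀.carrier I).inv ≫ S₀.mul ▷ I
  comm_unit : I ◁ S.unit ≫ eqToHom comm = (ρ_ I).hom ≫ (λ_ I).inv ≫ S₀.unit ▷ I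

section DistributiveLaw

variable {X₀ X : K} {I : X₀ ⟶ X} (T : RelMonad I) (S : CompatibleMonad I)

/-- For `d : S T ⟶ T S₀` and `f : I A ⟶ T B`, the 2-cell
`d B · S f : I S₀ A = S I A ⟶ S T B ⟶ T S₀ B`. -/
def twist (d : T.carrier ≫ S.S.carrier ⟶ S.S₀.carrier ≫ T.carrier) {O : K} {A B : O ⟶ X₀}
    (f : A ≫ I ⟶ B ≫ T.carrier) :
    (A ≫ S.S₀.carrier) ≫ I ⟶ (B ≫ S.S₀.carrier) ≫ T.carrier :=
  (α_ A S.S₀.carrier I).hom ≫ A ◁ eqToHom S.comm.symm ≫ (α_ A I S.S.carrier).inv ≫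
    f ▷ S.S.carrier ≫ (α_ B T.carrier S.S.carrier).hom ≫ B ◁ d ≫
    (α_ B S.S₀.carrier T.carrier).inv

/-- A relative distributive law of `T` over `(S, S₀)`: a 2-cell `d : S T ⟶ T S₀` such that
(D1) `d · m T = T m₀ · d S₀ · S d`, (D2) `d · s T = T s₀`,
(D3) `d B · S f† = (d B · S f)† · d A` for all `f : I A ⟶ T B`, and (D4) `d · S t = t S₀`. -/
@[ext]
structure RelDistrLaw where
  d : T.carrier ≫ S.S.carrier ⟶ S.S₀.carrier ≫ T.carrier
  D1 : T.carrier ◁ S.S.mul ≫ d =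
    (α_ T.carrier S.S.carrier S.S.carrier).inv ≫ d ▷ S.S.carrier ≫
      (α_ S.S₀.carrier T.carrier S.S.carrier).hom ≫ S.S₀.carrier ◁ d ≫
      (α_ S.S₀.carrier S.S₀.carrier T.carrier).inv ≫ S.S₀.mul ▷ T.carrier
  D2 : (ρ_ T.carrier).inv ≫ T.carrier ◁ S.S.unit ≫ d =
    (λ_ T.carrier).inv ≫ S.S₀.unit ▷ T.carrier
  D3 : ∀ {O : K} {A B : O ⟶ X₀} (f : A ≫ I ⟶ B ≫ T.carrier),
    (α_ A T.carrier S.S.carrier).inv ≫ T.ext.app f ▷ S.S.carrier ≫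
        (α_ B T.carrier S.S.carrier).hom ≫ B ◁ d ≫ (α_ B S.S₀.carrier T.carrier).inv =
      A ◁ d ≫ (α_ A S.S₀.carrier T.carrier).inv ≫ T.ext.app (twist T S d f)
  D4 : T.unit ▷ S.S.carrier ≫ d = eqToHom S.comm ≫ S.S₀.carrier ◁ T.unit

end DistributiveLaw

/-! ### 2-functors to categories, 2-natural transformations, modifications

The universe levels of the categories are left free, because `K(X, -)` and `Mod_T(-)` take values
in categories of different sizes. -/

/-- A (strict) 2-functor from `K` to the 2-category of categories. -/
structure CatFunctor (K : Type u) [Bicategory.{w, v} K] where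
  obj : K → Type v₁
  [cat : ∀ k, Category.{w₁} (obj k)]
  map : ∀ {k l : K}, (k ⟶ l) → (obj k ⥤ obj l)
  map₂ : ∀ {k l : K} {N N' : k ⟶ l}, (N ⟶ N') → (map N ⟶ map N')
  map_id : ∀ k : K, map (𝟙 k) = 𝟭 (obj k)
  map_comp : ∀ {k l j : K} (N : k ⟶ l) (P : l ⟶ j), map (N ≫ P) = map N ⋙ map P
  map₂_id : ∀ {k l : K} (N : k ⟶ l), map₂ (𝟙 N) = 𝟙 (map N)
  map₂_comp : ∀ {k l : K} {N N' N'' : k ⟶ l} (a : N ⟶ N') (b : N' ⟶ N''),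
    map₂ (a ≫ b) = map₂ a ≫ map₂ b
  map₂_whiskerLeft : ∀ {k l j : K} (N : k ⟶ l) {P P' : l ⟶ j} (b : P ⟶ P'),
    map₂ (N ◁ b) = eqToHom (map_comp N P) ≫ Functor.whiskerLeft (map N) (map₂ b) ≫
      eqToHom (map_comp N P').symm
  map₂_whiskerRight : ∀ {k l j : K} {N N' : k ⟶ l} (a : N ⟶ N') (P : l ⟶ j),
    map₂ (a ▷ P) = eqToHom (map_comp N P) ≫ Functor.whiskerRight (map₂ a) (map P) ≫
      eqToHom (map_comp N' P).symm

attribute [instance] CatFunctor.cat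

/-- A (strict) 2-natural transformation. -/
@[ext]
structure Trans (F : CatFunctor.{w, v, u, w₁, v₁} K) (G : CatFunctor.{w, v, u, w₂, v₂} K) where
  app : ∀ k : K, F.obj k ⥤ G.obj k
  naturality : ∀ {k l : K} (N : k ⟶ l), F.map N ⋙ app l = app k ⋙ G.map N
  naturality₂ : ∀ {k l : K} {N N' : k ⟶ l} (a : N ⟶ N'),
    Functor.whiskerRight (F.map₂ a) (app l) = eqToHom (naturality N) ≫
      Functor.whiskerLeft (app k) (G.map₂ a) ≫ eqToHom (naturality N').symm

section

variable {F : CatFunctor.{w, v, u, w₁, v₁} K} {G : CatFunctor.{w, v, u, w₂, v₂} K}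
  {H : CatFunctor.{w, v, u, w₃, v₃} K}

theorem Trans.naturality_obj (α : Trans F G) {k l : K} (N : k ⟶ l) (M : F.obj k) :
    (α.app l).obj ((F.map N).obj M) = (G.map N).obj ((α.app k).obj M) :=
  Functor.congr_obj (α.naturality N) M

/-- A modification between 2-natural transformations. -/
@[ext]
structure Modif (α β : Trans F G) where
  app : ∀ k : K, α.app k ⟶ β.app k
  naturality : ∀ {k l : K} (N : k ⟶ l),
    Functor.whiskerLeft (F.map N) (app l) = eqToHom (α.naturality N) ≫
      Functor.whiskerRight (app k) (G.map N) ≫ eqToHom (β.naturality N).symm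

theorem Modif.naturality_app {α β : Trans F G} (φ : Modif α β) {k l : K} (N : k ⟶ l)
    (M : F.obj k) :
    (φ.app l).app ((F.map N).obj M) = eqToHom (α.naturality_obj N M) ≫
      (G.map N).map ((φ.app k).app M) ≫ eqToHom (β.naturality_obj N M).symm := by
  have h := congrArg (fun θ => θ.app M) (φ.naturality N)
  simpa [eqToHom_app] using h

/-- The identity modification between equal transformations. -/
def Modif.ofEq {α β : Trans F G} (h : α = β) : Modif α β where
  app k := eqToHom (by rw [h])
  naturality N := by subst h; simp

/-- The identity 2-natural transformation. -/
abbrev Trans.id (F : CatFunctor.{w, v, u, w₁, v₁} K) : Trans F F where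
  app k := 𝟭 (F.obj k)
  naturality N := rfl
  naturality₂ a := by ext M; simp

/-- The composite `β ∘ α` of 2-natural transformations (diagrammatic order). -/
abbrev Trans.comp (α : Trans F G) (β : Trans G H) : Trans F H where
  app k := α.app k ⋙ β.app k
  naturality {k l} N := by
    rw [← Functor.assoc, α.naturality, Functor.assoc, β.naturality, Functor.assoc]
  naturality₂ {k l N N'} a := by
    ext M
    have h1 := congrArg (fun θ => (β.app l).map (θ.app M)) (α.naturality₂ a)
    have h2 := congrArg (fun θ => θ.app ((α.app k).obj M)) (β.naturality₂ a)
    simp only [Functor.whiskerRight_app, Functor.whiskerLeft_app, NatTrans.comp_app, eqToHom_app,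
      Functor.map_comp, eqToHom_map, Functor.comp_map] at h1 h2 ⊢
    rw [h1, h2]
    simp

end

/-- A monad in the 2-category of 2-functors, 2-natural transformations and modifications; the
axioms are written on components. -/
structure TransMonad (F : CatFunctor.{w, v, u, w₁, v₁} K) where
  trans : Trans F F
  mul : Modif (trans.comp trans) trans
  unit : Modif (Trans.id F) trans
  assoc : ∀ (k : K) (M : F.obj k),
    (trans.app k).map ((mul.app k).app M) ≫ (mul.app k).app M =
      (mul.app k).app ((trans.app k).obj M) ≫ (mul.app k).app M
  unit_left : ∀ (k : K) (M : F.obj k),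
    (unit.app k).app ((trans.app k).obj M) ≫ (mul.app k).app M = 𝟙 ((trans.app k).obj M)
  unit_right : ∀ (k : K) (M : F.obj k),
    (trans.app k).map ((unit.app k).app M) ≫ (mul.app k).app M = 𝟙 ((trans.app k).obj M)

section MonadMorphism

variable {F : CatFunctor.{w, v, u, w₁, v₁} K} {G : CatFunctor.{w, v, u, w₂, v₂} K}
  {H : CatFunctor.{w, v, u, w₃, v₃} K}

/-- `(V, φ)` with `φ : V P ⟶ Q V` is a 1-cell `(F, P) ⟶ (G, Q)` of `Mnd(L^op)^op`, where `L` is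
the 2-category of 2-functors, i.e. `φ` respects units and multiplications. -/
structure IsMonadMorphism (P : TransMonad F) (Q : TransMonad G) (V : Trans F G)
    (φ : Modif (P.trans.comp V) (V.comp Q.trans)) : Prop where
  unit : ∀ (k : K) (M : F.obj k),
    (V.app k).map ((P.unit.app k).app M) ≫ (φ.app k).app M =
      (Q.unit.app k).app ((V.app k).obj M)
  mul : ∀ (k : K) (M : F.obj k),
    (V.app k).map ((P.mul.app k).app M) ≫ (φ.app k).app M =
      (φ.app k).app ((P.trans.app k).obj M) ≫ (Q.trans.app k).map ((φ.app k).app M) ≫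
        (Q.mul.app k).app ((V.app k).obj M)

/-- The 2-cell `ψ V · W φ : W V P ⟶ W Q V ⟶ R W V` of the composite `(W, ψ) ∘ (V, φ)`. -/
def compCell {P : Trans F F} {Q : Trans G G} {R : Trans H H} {V : Trans F G} {W : Trans G H}
    (φ : Modif (P.comp V) (V.comp Q)) (ψ : Modif (Q.comp W) (W.comp R)) :
    Modif (P.comp (V.comp W)) ((V.comp W).comp R) where
  app k :=
    { app := fun M => (W.app k).map ((φ.app k).app M) ≫ (ψ.app k).app ((V.app k).obj M)
      naturality := fun M M' g => by
        have h1 := congrArg (W.app k).map ((φ.app k).naturality g)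
        have h2 := (ψ.app k).naturality ((V.app k).map g)
        simp only [Trans.comp, Functor.comp_map, Functor.map_comp] at h1 h2 ⊢
        rw [← Category.assoc, h1, Category.assoc, h2, Category.assoc] }
  naturality {k l} N := by
    ext M
    have h1 := congrArg (W.app l).map (φ.naturality_app N M)
    have h2 := ψ.naturality_app N ((V.app k).obj M)
    have h3 : ∀ {y z : G.obj l} (e : y = z), (ψ.app l).app y =
        eqToHom (by rw [e]) ≫ (ψ.app l).app z ≫ eqToHom (by rw [e]) := by
      rintro y z rfl; simp
    have h4 := h3 (V.naturality_obj N M)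
    have h5 := Functor.congr_hom (W.naturality N) ((φ.app k).app M)
    simp only [Functor.comp_map] at h5
    simp only [Functor.whiskerRight_app, Functor.whiskerLeft_app, NatTrans.comp_app, eqToHom_app,
      Functor.map_comp]
    rw [h1, h4, h2]
    simp only [Functor.map_comp, eqToHom_map]
    rw [h5]
    simp

/-- `τ : V ⟶ W` is a 2-cell `(V, φ) ⟶ (W, ψ)` of `Mnd(L^op)^op`. -/
def IsMonadTransformation (P : TransMonad F) (Q : TransMonad G) {V W : Trans F G}
    (φ : Modif (P.trans.comp V) (V.comp Q.trans)) (ψ : Modif (P.trans.comp W) (W.comp Q.trans))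
    (τ : Modif V W) : Prop :=
  ∀ (k : K) (M : F.obj k),
    (τ.app k).app ((P.trans.app k).obj M) ≫ (ψ.app k).app M =
      (φ.app k).app M ≫ (Q.trans.app k).map ((τ.app k).app M)

end MonadMorphism

/-! ### Relative right modules -/

section Modules

variable {X₀ X : K} {I : X₀ ⟶ X}

/-- A `k`-indexed relative right `T`-module `(M, (-)_m)`: `carrier` is `M`, `act` is `(-)_m`. -/
structure RightModule (T : RelMonad I) (k : K) where
  carrier : X₀ ⟶ k
  act : Operator I T.carrier carrier carrier
  unit : act.app ((λ_ I).hom ≫ T.unit ≫ (λ_ T.carrier).inv) = 𝟙 (𝟙 X₀ ≫ carrier)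
  assoc : ∀ {O : K} {A B C : O ⟶ X₀} (h : A ≫ I ⟶ B ≫ T.carrier) (l : B ≫ I ⟶ C ≫ T.carrier),
    act.app (h ≫ T.ext.app l) = act.app h ≫ act.app l

namespace RightModule

variable {T : RelMonad I}

/-- A morphism of `k`-indexed relative right modules. -/
@[ext]
structure Hom {k : K} (M N : RightModule T k) where
  hom : M.carrier ⟶ N.carrier
  comm : ∀ {O : K} {A B : O ⟶ X₀} (h : A ≫ I ⟶ B ≫ T.carrier),
    M.act.app h ≫ B ◁ hom = A ◁ hom ≫ N.act.app h

instance (k : K) : Category (RightModule T k) where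
  Hom M N := Hom M N
  id M := { hom := 𝟙 M.carrier, comm := fun h => by simp }
  comp f g :=
    { hom := f.hom ≫ g.hom
      comm := fun h => by
        rw [whiskerLeft_comp, whiskerLeft_comp, Category.assoc, ← g.comm, ← Category.assoc, f.comm,
          Category.assoc] }

@[ext]
theorem hom_ext {k : K} {M N : RightModule T k} {f g : M ⟶ N} (h : f.hom = g.hom) : f = g :=
  Hom.ext h

@[simp]
theorem id_hom {k : K} (M : RightModule T k) : Hom.hom (𝟙 M) = 𝟙 M.carrier := rfl

@[simp]
theorem comp_hom {k : K} {M N P : RightModule T k} (f : M ⟶ N) (g : N ⟶ P) :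
    (f ≫ g).hom = f.hom ≫ g.hom := rfl

theorem eqToHom_hom {k : K} {M N : RightModule T k} (h : M = N) :
    (eqToHom h).hom = eqToHom (congrArg RightModule.carrier h) := by
  subst h; rfl

theorem ext_of_eqToHom {k : K} {M N : RightModule T k} (h : M.carrier = N.carrier)
    (w : ∀ {O : K} {A B : O ⟶ X₀} (f : A ≫ I ⟶ B ≫ T.carrier),
      M.act.app f = A ◁ eqToHom h ≫ N.act.app f ≫ B ◁ eqToHom h.symm) : M = N := by
  obtain ⟨c, a, _, _⟩ := M
  obtain ⟨c', a', _, _⟩ := N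
  obtain rfl : c = c' := h
  obtain rfl : a = a' := by
    ext O A B f
    simpa using w f
  rfl

/-- `T` itself, with its extension operator, is an `X`-indexed relative right `T`-module. -/
abbrev self (T : RelMonad I) : RightModule T X where
  carrier := T.carrier
  act := T.ext
  unit := T.right_unit
  assoc := T.assoc

/-- The module `(N M, N (-)_m)` for `N : k ⟶ l`. -/
abbrev push {k l : K} (N : k ⟶ l) (M : RightModule T k) : RightModule T l where
  carrier := M.carrier ≫ N
  act :=
    { app := fun {O A B} f => (α_ A M.carrier N).inv ≫ M.act.app f ▷ N ≫ (α_ B M.carrier N).hom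
      indexing := by
        intro O' O P A B f
        rw [M.act.indexing]
        simp
      left_naturality := fun a f => by
        rw [M.act.left_naturality]
        simp
      right_naturality := fun f b => by
        rw [M.act.right_naturality]
        simp }
  unit := by
    dsimp only
    rw [M.unit]
    simp
  assoc h l := by
    dsimp only
    rw [M.assoc]
    simp

end RightModule

end Modules

section Strict

variable [Bicategory.Strict K]

theorem assoc_hom {a b c d : K} (f : a ⟶ b) (g : b ⟶ c) (h : c ⟶ d) :
    (α_ f g h).hom = eqToHom (Bicategory.Strict.assoc f g h) := by
  rw [Bicategory.Strict.associator_eqToIso]; rfl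

theorem assoc_inv {a b c d : K} (f : a ⟶ b) (g : b ⟶ c) (h : c ⟶ d) :
    (α_ f g h).inv = eqToHom (Bicategory.Strict.assoc f g h).symm := by
  rw [Bicategory.Strict.associator_eqToIso]; rfl

theorem whiskerRight_id_eq {a b : K} {f g : a ⟶ b} (η : f ⟶ g) :
    η ▷ 𝟙 b = eqToHom (Bicategory.Strict.comp_id f) ≫ η ≫
      eqToHom (Bicategory.Strict.comp_id g).symm := by
  rw [Bicategory.whiskerRight_id, Bicategory.Strict.rightUnitor_eqToIso,
    Bicategory.Strict.rightUnitor_eqToIso]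
  rfl

/-- The representable 2-functor `K(X, -)`. -/
abbrev Rep (X : K) : CatFunctor.{w, v, u, w, v} K where
  obj k := X ⟶ k
  map {k l} N := { obj := fun (M : X ⟶ k) => M ≫ N, map := fun {_ _} f => f ▷ N }
  map₂ {k l N N'} a :=
    { app := fun (M : X ⟶ k) => M ◁ a, naturality := fun _ _ f => (whisker_exchange f a).symm }
  map_id k := CategoryTheory.Functor.ext (fun M => Bicategory.Strict.comp_id M) (fun (M M' : _ ⟶ _) f =>
    whiskerRight_id_eq f)
  map_comp N P := CategoryTheory.Functor.ext (fun M => (Bicategory.Strict.assoc M N P).symm) (fun (M M' : _ ⟶ _) f => by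
    simp [assoc_hom, assoc_inv])
  map₂_id N := by ext M; simp
  map₂_comp a b := by ext M; simp
  map₂_whiskerLeft N P P' b := by ext M; simp [eqToHom_app, assoc_hom, assoc_inv]
  map₂_whiskerRight a P := by ext M; simp [eqToHom_app, assoc_hom, assoc_inv]

/-- The 2-natural transformation `- ∘ F : K(Y, -) ⟶ K(X, -)`. -/
abbrev pre {X Y : K} (F : X ⟶ Y) : Trans (Rep Y) (Rep X) where
  app k := { obj := fun (M : Y ⟶ k) => F ≫ M, map := fun {_ _} f => F ◁ f }
  naturality N := CategoryTheory.Functor.ext (fun M => (Bicategory.Strict.assoc F M N).symm) (fun (M M' : _ ⟶ _) f => by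
    simp [assoc_hom, assoc_inv])
  naturality₂ a := by ext M; simp [eqToHom_app, assoc_hom, assoc_inv]

/-- The modification `- ∘ a : (- ∘ F) ⟶ (- ∘ F')` for a 2-cell `a : F ⟶ F'`. -/
abbrev preCell {X Y : K} {F F' : X ⟶ Y} (a : F ⟶ F') : Modif (pre F) (pre F') where
  app k := { app := fun (M : Y ⟶ k) => a ▷ M, naturality := fun _ _ f => whisker_exchange a f }
  naturality N := by ext M; simp [eqToHom_app, assoc_hom, assoc_inv]

section ModFunctor

variable {X₀ X : K} {I : X₀ ⟶ X} (T : RelMonad I)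

/-- The 2-functor `Mod_T(-)` of relative right `T`-modules. -/
abbrev Mod : CatFunctor.{w, v, u, w, max u v w} K where
  obj k := RightModule T k
  map {k l} N :=
    { obj := fun M => M.push N
      map := fun {M M'} f =>
        { hom := f.hom ▷ N
          comm := fun {O A B} h => by
            have e := congrArg (fun g => (α_ A M.carrier N).inv ≫ g ▷ N ≫
              (α_ B M'.carrier N).hom) (f.comm h)
            simpa using e }
      map_id := fun M => by ext; simp
      map_comp := fun f g => by ext; simp }
  map₂ {k l N N'} a :=
    { app := fun M =>
        { hom := M.carrier ◁ a
          comm := fun {O A B} h => by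
            simp only [Category.assoc]
            rw [← associator_naturality_right, associator_inv_naturality_right_assoc,
              whisker_exchange_assoc] }
      naturality := fun M M' f => by
        ext
        exact (whisker_exchange f.hom a).symm }
  map_id k := CategoryTheory.Functor.ext
    (fun M => RightModule.ext_of_eqToHom (Bicategory.Strict.comp_id M.carrier) (by
      intro O A B f
      simp [whiskerRight_id_eq, assoc_hom, assoc_inv, -Bicategory.whiskerRight_id]))
    (fun M M' f => by
      ext
      simp [whiskerRight_id_eq, RightModule.eqToHom_hom, -Bicategory.whiskerRight_id])
  map_comp {k l j} N P := CategoryTheory.Functor.ext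
    (fun M => RightModule.ext_of_eqToHom (Bicategory.Strict.assoc M.carrier N P).symm (by
      intro O A B f
      simp [assoc_hom, assoc_inv]))
    (fun M M' f => by
      ext
      simp [RightModule.eqToHom_hom, assoc_hom, assoc_inv])
  map₂_id N := by ext M; simp
  map₂_comp a b := by ext M; simp
  map₂_whiskerLeft N P P' b := by
    ext M; simp [eqToHom_app, RightModule.eqToHom_hom, assoc_hom, assoc_inv]
  map₂_whiskerRight a P := by
    ext M; simp [eqToHom_app, RightModule.eqToHom_hom, assoc_hom, assoc_inv]

/-- `U* : K(X, -) ⟶ Mod_T(-)`, `M ↦ (M T, M (-)†)`. -/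
abbrev freeTrans : Trans (Rep X) (Mod T) where
  app k :=
    { obj := fun (M : X ⟶ k) => (RightModule.self T).push M
      map := fun {M M'} f => ((Mod T).map₂ f).app (RightModule.self T)
      map_id := fun M => by ext; simp
      map_comp := fun f g => by ext; simp }
  naturality {k l} N := CategoryTheory.Functor.ext
    (fun (M : X ⟶ k) => Functor.congr_obj ((Mod T).map_comp M N) (RightModule.self T))
    (fun (M M' : X ⟶ k) f => by
      ext; simp [RightModule.eqToHom_hom, assoc_hom, assoc_inv])
  naturality₂ a := by
    ext M; simp [eqToHom_app, RightModule.eqToHom_hom, assoc_hom, assoc_inv]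

/-- `J* : Mod_T(-) ⟶ K(X₀, -)`, forgetting the module structure. -/
abbrev forgetTrans : Trans (Mod T) (Rep X₀) where
  app k :=
    { obj := fun M => M.carrier
      map := fun f => f.hom }
  naturality N := rfl
  naturality₂ a := by ext M; simp

/-- The modification `t : (- ∘ I) ⟶ J* U*` with components `M t : M I ⟶ M T`. -/
abbrev unitCell : Modif (pre I) ((freeTrans T).comp (forgetTrans T)) where
  app k :=
    { app := fun (M : X ⟶ k) => T.unit ▷ M
      naturality := fun _ _ f => whisker_exchange T.unit f }
  naturality N := by
    ext M; simp [eqToHom_app, assoc_hom, assoc_inv]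

end ModFunctor

/-- The monad `- ∘ S` on `K(X, -)` induced by a monad `S` on `X`. -/
abbrev preMonad {X : K} (S : MonadIn X) : TransMonad (Rep X) where
  trans := pre S.carrier
  mul :=
    { app := fun k =>
        { app := fun (M : X ⟶ k) => (α_ S.carrier S.carrier M).inv ≫ S.mul ▷ M
          naturality := fun (M M' : X ⟶ k) f => by
            simp only [Functor.comp_map, Category.assoc]
            rw [← whisker_exchange, ← associator_inv_naturality_right_assoc] }
      naturality := fun N => by
        ext M; simp [eqToHom_app, assoc_hom, assoc_inv] }
  unit :=
    { app := fun k =>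
        { app := fun (M : X ⟶ k) => (λ_ M).inv ≫ S.unit ▷ M
          naturality := fun (M M' : X ⟶ k) f => by
            simp only [Functor.id_map, Category.assoc]
            rw [← whisker_exchange]
            simp }
      naturality := fun N => by
        ext M; simp [eqToHom_app, assoc_hom, assoc_inv] }
  assoc k M := by
    have e := congrArg (fun g => g ▷ M) S.assoc
    simp at e ⊢
    rw [e]
    simp [assoc_hom, assoc_inv]
  unit_left k M := by
    have e := congrArg (fun g => g ▷ M) S.unit_left
    simp at e ⊢
    rw [e]
    simp
  unit_right k M := by
    have e := congrArg (fun g => (α_ S.carrier (𝟙 X) M).inv ≫ g ▷ M) S.unit_right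
    simp at e ⊢
    rw [e]
    simp

/-- The strict equality `(- ∘ I)(- ∘ S) = (- ∘ S₀)(- ∘ I)` induced by `S I = I S₀`. -/
theorem pre_comm {X₀ X : K} {I : X₀ ⟶ X} (S : CompatibleMonad I) :
    (pre S.S.carrier).comp (pre I) = (pre I).comp (pre S.S₀.carrier) := by
  have hobj : ∀ {k : K} (M : X ⟶ k),
      I ≫ (S.S.carrier ≫ M) = S.S₀.carrier ≫ (I ≫ M) := fun M => by
    rw [← Bicategory.Strict.assoc, S.comm, Bicategory.Strict.assoc]
  apply Trans.ext
  funext k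
  refine CategoryTheory.Functor.ext (fun (M : X ⟶ k) => hobj M) (fun (M M' : X ⟶ k) f => ?_)
  have e : (I ≫ S.S.carrier) ◁ f =
      eqToHom (by rw [S.comm]) ≫ (S.S₀.carrier ≫ I) ◁ f ≫ eqToHom (by rw [S.comm]) :=
    congr_whiskerLeft S.comm f
  have e' : I ◁ S.S.carrier ◁ f = (α_ I S.S.carrier M).inv ≫ (I ≫ S.S.carrier) ◁ f ≫
      (α_ I S.S.carrier M').hom := by simp
  change I ◁ S.S.carrier ◁ f = _
  rw [e', e]
  simp [assoc_hom, assoc_inv]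

end Strict

/-! ### Liftings of a monad to relative right modules -/

theorem obj_of_comm {F : CatFunctor.{w, v, u, w₁, v₁} K} {G : CatFunctor.{w, v, u, w₂, v₂} K}
    {P : Trans F F} {Q : Trans G G} {V : Trans F G} (h : P.comp V = V.comp Q) (k : K)
    (M : F.obj k) : (V.app k).obj ((P.app k).obj M) = (Q.app k).obj ((V.app k).obj M) :=
  congrArg (fun α => (Trans.app α k).obj M) h

/-- The monad pair `(P, Q)` is compatible with the 2-natural transformation `V : F ⟶ G`:
`V P = Q V`, and `V` sends the multiplication and unit of `P` to those of `Q`. -/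
structure IsCompatible {F : CatFunctor.{w, v, u, w₁, v₁} K} {G : CatFunctor.{w, v, u, w₂, v₂} K}
    (P : TransMonad F) (Q : TransMonad G) (V : Trans F G) : Prop where
  comm : P.trans.comp V = V.comp Q.trans
  mul : ∀ (k : K) (M : F.obj k),
    (V.app k).map ((P.mul.app k).app M) ≫ eqToHom (obj_of_comm comm k M) =
      eqToHom (by simp only [Functor.comp_obj]; rw [obj_of_comm comm, obj_of_comm comm]) ≫ (Q.mul.app k).app ((V.app k).obj M)
  unit : ∀ (k : K) (M : F.obj k),
    (V.app k).map ((P.unit.app k).app M) ≫ eqToHom (obj_of_comm comm k M) =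
      (Q.unit.app k).app ((V.app k).obj M)

section Lifting

variable [Bicategory.Strict K] {X₀ X : K} {I : X₀ ⟶ X} (T : RelMonad I) (S : CompatibleMonad I)

/-- A lifting of `S` to the relative right modules of `T`: a monad `S~` on `Mod_T(-)` and a
2-cell `d* : U* (- ∘ S) ⟶ S~ U*` (components `M S T ⟶ S~ (M T)`) such that
(i) `(S~, - ∘ S₀)` is compatible with `J*`; (ii) `(U*, d*)` is a monad morphism
`(K(X, -), - ∘ S) ⟶ (Mod_T(-), S~)`; (iii) `t : (- ∘ I, 1) ⟶ (J*, 1) ∘ (U*, d*)` is a 2-cell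
between monad morphisms; (iv) `f_{S~ m} = (f_{S~ T} · t S₀ A)_m` for all `f : I A ⟶ T B` and
all modules `(M, (-)_m)`, where `f_{S~ T}` is the action of the module `S~ (T, (-)†)`. -/
@[ext]
structure Lifting where
  monad : TransMonad (Mod T)
  dstar : Modif ((pre S.S.carrier).comp (freeTrans T)) ((freeTrans T).comp monad.trans)
  compatible : IsCompatible monad (preMonad S.S₀) (forgetTrans T)
  morphism : IsMonadMorphism (preMonad S.S) monad (freeTrans T) dstar
  transformation : IsMonadTransformation (preMonad S.S) (preMonad S.S₀)
    (Modif.ofEq (pre_comm S)) (compCell dstar (Modif.ofEq compatible.comm)) (unitCell T)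
  action : ∀ {k : K} (M : RightModule T k) {O : K} {A B : O ⟶ X₀} (f : A ≫ I ⟶ B ≫ T.carrier),
    ((monad.trans.app k).obj M).act.app f =
      A ◁ eqToHom (obj_of_comm compatible.comm k M) ≫ (α_ A S.S₀.carrier M.carrier).inv ≫
        M.act.app
          ((α_ A S.S₀.carrier I).hom ≫ A ◁ (S.S₀.carrier ◁ T.unit) ≫
            A ◁ eqToHom (obj_of_comm compatible.comm X (RightModule.self T)).symm ≫
            ((monad.trans.app X).obj (RightModule.self T)).act.app f ≫
            B ◁ eqToHom (obj_of_comm compatible.comm X (RightModule.self T)) ≫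
            (α_ B S.S₀.carrier T.carrier).inv) ≫
        (α_ B S.S₀.carrier M.carrier).hom ≫ B ◁ eqToHom (obj_of_comm compatible.comm k M).symm

end Lifting

end TwoCategory

end RelMnd

/-!
From a law `d` to a lifting.  For a 2-cell `f : I A ⟶ T B` put `f' := d B · S f` (`twist`), a 2-cell
`I S₀ A ⟶ T S₀ B`.  The four axioms of a law say exactly how `f ↦ f'` interacts with the structure
of a relative monad and of `(S, S₀)`: (D4) gives `(t A)' = t S₀ A`, (D3) gives
`(l† · h)' = l'† · h'`, and (D1), (D2) make `f'` compatible with `m₀` and `s₀`.  Hence, for every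
module `(M, (-)_m)`, the 1-cell `M S₀` with the operator `f ↦ (f')_m` is a module (`liftModule`),
`M m₀` and `M s₀` are module morphisms (`liftMonad`), and (D3) once more says that `M d` is a module
morphism `(M S T, M S (-)†) ⟶ S~ (M T, M (-)†)` (`liftCell`).

From a lifting to a law.  By 2-naturality the modification `d*` is determined by its component at
the identity 1-cell of `X`, a 2-cell `d : S T ⟶ T S₀`, and `J* d*_M = M d` (`Lifting.cell_eq`).
That `d*` respects units and multiplications gives (D1) and (D2), condition (iii) gives (D4).
That `d` is a module morphism reads `d B · S f† = f_{S~ T} · d A`; composing with `S t A` and using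
(D4) gives `f_{S~ T} · t S₀ A = d B · S f` (`Lifting.unit_liftAct`).  With this, condition (iv)
becomes `f_{S~ m} = (d B · S f)_m` (`Lifting.act_eq`), which for `M = T` turns the previous identity
into (D3).

The same formulas show that a lifting is determined by its `d` (`Lifting.eq_of_lawCell_eq`), as
`J*` prescribes carriers, the action of `S~` on morphisms, its multiplication and its unit.  So
the two constructions are mutually inverse.
-/

namespace RelMnd

/-! ### The 2-cells `d B · S f` -/

variable {K : Type u} [Bicategory.{w, v} K] {X₀ X : K} {I : X₀ ⟶ X}

/-- `f` can be exchanged with a 2-cell `m` applied after it, when the domain and the codomain of `f`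
are composites. -/
theorem whiskerLeft_exchange {a b b' c e : K} {A : a ⟶ b} {F : b ⟶ c} {B : a ⟶ b'} {G : b' ⟶ c}
    (f : A ≫ F ⟶ B ≫ G) {P Q : c ⟶ e} (m : P ⟶ Q) :
    A ◁ F ◁ m ≫ (α_ A F Q).inv ≫ f ▷ Q =
      (α_ A F P).inv ≫ f ▷ P ≫ (α_ B G P).hom ≫ B ◁ G ◁ m ≫ (α_ B G Q).inv := by
  rw [associator_inv_naturality_right_assoc, whisker_exchange, comp_whiskerLeft]

/-- The unit law of a module along an arbitrary 1-cell `A`: indexing reduces `(t A)_m = 1` to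
`t_m = 1`, up to replacing `A ≫ 𝟙` by `A`. -/
theorem RightModule.act_whiskerLeft_unit {T : RelMonad I} {k : K} (M : RightModule T k)
    {O : K} (A : O ⟶ X₀) : M.act.app (A ◁ T.unit) = 𝟙 (A ≫ M.carrier) := by
  have h := M.act.indexing A ((λ_ I).hom ≫ T.unit ≫ (λ_ T.carrier).inv)
  rw [M.unit] at h
  have e : (α_ A (𝟙 X₀) I).hom ≫ A ◁ ((λ_ I).hom ≫ T.unit ≫ (λ_ T.carrier).inv) ≫
      (α_ A (𝟙 X₀) T.carrier).inv = (ρ_ A).hom ▷ I ≫ A ◁ T.unit ≫ (ρ_ A).inv ▷ T.carrier := by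
    simp
  rw [e, M.act.left_naturality, M.act.right_naturality] at h
  simp only [whiskerLeft_id, Category.id_comp, Iso.hom_inv_id] at h
  rw [← cancel_epi ((ρ_ A).hom ▷ M.carrier), ← cancel_mono ((ρ_ A).inv ▷ M.carrier)]
  simpa using h

section Twist

variable {T : RelMonad I} {S : CompatibleMonad I}
  (d : T.carrier ≫ S.S.carrier ⟶ S.S₀.carrier ≫ T.carrier)

theorem twist_left_naturality {O : K} {A' A B : O ⟶ X₀} (a : A' ⟶ A)
    (f : A ≫ I ⟶ B ≫ T.carrier) :
    twist T S d (a ▷ I ≫ f) = (a ▷ S.S₀.carrier) ▷ I ≫ twist T S d f := by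
  simp only [twist, comp_whiskerRight, Category.assoc]
  rw [associator_naturality_left_assoc, ← whisker_exchange_assoc,
    ← associator_inv_naturality_left_assoc]

theorem twist_right_naturality {O : K} {A B B' : O ⟶ X₀} (f : A ≫ I ⟶ B ≫ T.carrier)
    (b : B ⟶ B') :
    twist T S d (f ≫ b ▷ T.carrier) = twist T S d f ≫ (b ▷ S.S₀.carrier) ▷ T.carrier := by
  simp only [twist, comp_whiskerRight, Category.assoc]
  rw [associator_naturality_left_assoc, ← whisker_exchange_assoc,
    ← associator_inv_naturality_left]

theorem twist_indexing {O' O : K} (P : O' ⟶ O) {A B : O ⟶ X₀} (f : A ≫ I ⟶ B ≫ T.carrier) :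
    twist T S d ((α_ P A I).hom ≫ P ◁ f ≫ (α_ P B T.carrier).inv) =
      (α_ P A S.S₀.carrier).hom ▷ I ≫ ((α_ P (A ≫ S.S₀.carrier) I).hom ≫ P ◁ twist T S d f ≫
        (α_ P (B ≫ S.S₀.carrier) T.carrier).inv) ≫ (α_ P B S.S₀.carrier).inv ▷ T.carrier := by
  simp [twist, -whiskerLeft_eqToHom]

end Twist

namespace CompatibleMonad

variable (S : CompatibleMonad I)

/-- `m I = I m₀`, with the identification `S I = I S₀` on the side on which `twist` uses it. -/
theorem mul_whiskerRight_eqToHom : S.S₀.mul ▷ I ≫ eqToHom S.comm.symm =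
    (α_ S.S₀.carrier S.S₀.carrier I).hom ≫ S.S₀.carrier ◁ eqToHom S.comm.symm ≫
      (α_ S.S₀.carrier I S.S.carrier).inv ≫ eqToHom S.comm.symm ▷ S.S.carrier ≫
      (α_ I S.S.carrier S.S.carrier).hom ≫ I ◁ S.S.mul := by
  have h := congrArg (fun g => (α_ S.S₀.carrier S.S₀.carrier I).hom ≫
    S.S₀.carrier ◁ eqToHom S.comm.symm ≫
      (α_ S.S₀.carrier I S.S.carrier).inv ≫ eqToHom S.comm.symm ▷ S.S.carrier ≫
      (α_ I S.S.carrier S.S.carrier).hom ≫ g ≫ eqToHom S.comm.symm) S.comm_mul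
  simp at h
  simp [h]

/-- `s I = I s₀`, with the identification `S I = I S₀` on the side on which `twist` uses it. -/
theorem unit_whiskerRight_eqToHom : S.S₀.unit ▷ I ≫ eqToHom S.comm.symm =
    (λ_ I).hom ≫ (ρ_ I).inv ≫ I ◁ S.S.unit := by
  have h := congrArg (fun g => (λ_ I).hom ≫ (ρ_ I).inv ≫ g ≫ eqToHom S.comm.symm) S.comm_unit
  simp at h
  simp [h]

end CompatibleMonad

namespace RelDistrLaw

variable {T : RelMonad I} {S : CompatibleMonad I} (d : RelDistrLaw T S)

/-- (D4) in terms of `twist`: `(t A)' = t S₀ A`. -/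
theorem twist_unit {O : K} (A : O ⟶ X₀) :
    twist T S d.d (A ◁ T.unit) = (A ≫ S.S₀.carrier) ◁ T.unit := by
  have h := congrArg (fun g => (α_ A S.S₀.carrier I).hom ≫ A ◁ eqToHom S.comm.symm ≫ A ◁ g ≫
    (α_ A S.S₀.carrier T.carrier).inv) d.D4
  simp [twist] at h ⊢
  exact h

/-- (D3) in terms of `twist`: `(l† · h)' = l'† · h'`. -/
theorem twist_comp_ext {O : K} {A B C : O ⟶ X₀} (h : A ≫ I ⟶ B ≫ T.carrier)
    (l : B ≫ I ⟶ C ≫ T.carrier) :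
    twist T S d.d (h ≫ T.ext.app l) = twist T S d.d h ≫ T.ext.app (twist T S d.d l) := by
  have e := d.D3 l
  have e' := congrArg (fun g => (α_ A S.S₀.carrier I).hom ≫ A ◁ eqToHom S.comm.symm ≫
    (α_ A I S.S.carrier).inv ≫ h ▷ S.S.carrier ≫ (α_ B T.carrier S.S.carrier).hom ≫ g) e
  simpa [twist] using e'

/-- (D1) in terms of `twist`: `T m₀ B · f'' = f' · I m₀ A`. -/
theorem twist_twist_mul {O : K} {A B : O ⟶ X₀} (f : A ≫ I ⟶ B ≫ T.carrier) :
    twist T S d.d (twist T S d.d f) ≫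
        ((α_ B S.S₀.carrier S.S₀.carrier).hom ≫ B ◁ S.S₀.mul) ▷ T.carrier =
      ((α_ A S.S₀.carrier S.S₀.carrier).hom ≫ A ◁ S.S₀.mul) ▷ I ≫ twist T S d.d f := by
  have h₁ := congrArg (fun g => B ◁ g) d.D1
  have h₂ := congrArg (fun g => A ◁ g) S.mul_whiskerRight_eqToHom
  simp only [whiskerLeft_comp] at h₁ h₂
  simp [twist, -whiskerLeft_eqToHom, -eqToHom_whiskerRight]
  have h₁' := congrArg (fun g => B ◁ (α_ T.carrier S.S.carrier S.S.carrier).hom ≫ g ≫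
    (α_ B S.S₀.carrier T.carrier).inv) h₁
  simp only [Category.assoc, whiskerLeft_hom_inv_assoc] at h₁'
  rw [← h₁', reassoc_of% h₂, reassoc_of% whiskerLeft_exchange f S.S.mul]
  bicategory

/-- (D2) in terms of `twist`: `f' · I s₀ A = T s₀ B · f`. -/
theorem twist_unit_monad {O : K} {A B : O ⟶ X₀} (f : A ≫ I ⟶ B ≫ T.carrier) :
    ((ρ_ A).inv ≫ A ◁ S.S₀.unit) ▷ I ≫ twist T S d.d f =
      f ≫ ((ρ_ B).inv ≫ B ◁ S.S₀.unit) ▷ T.carrier := by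
  have h₁ := congrArg (fun g => B ◁ g) d.D2
  have h₂ := congrArg (fun g => A ◁ g) S.unit_whiskerRight_eqToHom
  simp only [whiskerLeft_comp] at h₁ h₂
  simp [twist, -whiskerLeft_eqToHom, -eqToHom_whiskerRight]
  have h₁' := congrArg (fun g => g ≫ (α_ B S.S₀.carrier T.carrier).inv) h₁
  simp only [Category.assoc] at h₁'
  rw [← h₁', reassoc_of% h₂, reassoc_of% whiskerLeft_exchange f S.S.unit]
  bicategory

/-! ### The lifting of a relative distributive law -/

/-- The module `(M S₀, (d B · S (-))_m)` that a relative distributive law assigns to `(M, (-)_m)`.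
The unit axiom comes from (D4), associativity from (D3). -/
abbrev liftModule {k : K} (M : RightModule T k) : RightModule T k where
  carrier := S.S₀.carrier ≫ M.carrier
  act :=
    { app := fun {O A B} f => (α_ A S.S₀.carrier M.carrier).inv ≫ M.act.app (twist T S d.d f) ≫
        (α_ B S.S₀.carrier M.carrier).hom
      indexing := by
        intro O' O P A B f
        rw [twist_indexing, M.act.left_naturality, M.act.right_naturality, M.act.indexing]
        simp
      left_naturality := by
        intro O A' A B a f
        rw [twist_left_naturality, M.act.left_naturality]
        simp
      right_naturality := by
        intro O A B B' f b
        rw [twist_right_naturality, M.act.right_naturality]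
        simp }
  unit := by
    dsimp only
    rw [← id_whiskerLeft, d.twist_unit, M.act_whiskerLeft_unit]
    simp
  assoc h l := by
    dsimp only
    rw [d.twist_comp_ext, M.assoc]
    simp

/-- The functor `S~` on `k`-indexed modules, `g ↦ g S₀` on morphisms.  It is an `abbrev`, like the
definitions built on it, so that `J* S~ = (- ∘ S₀) J*` holds definitionally. -/
abbrev liftFunctor (k : K) : RightModule T k ⥤ RightModule T k where
  obj M := d.liftModule M
  map {M N} g :=
    { hom := S.S₀.carrier ◁ g.hom
      comm := fun {O A B} f => by
        have e := congrArg (fun x => (α_ A S.S₀.carrier M.carrier).inv ≫ x ≫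
          (α_ B S.S₀.carrier N.carrier).hom) (g.comm (twist T S d.d f))
        simpa using e }
  map_id M := by ext; simp
  map_comp f g := by ext; simp

variable [Bicategory.Strict K]

/-- The 2-natural transformation `S~` on `Mod_T(-)`. -/
abbrev liftTrans : Trans (Mod T) (Mod T) where
  app k := d.liftFunctor k
  naturality {k l} N := CategoryTheory.Functor.ext
    (fun M => RightModule.ext_of_eqToHom (Bicategory.Strict.assoc _ _ _).symm (by
      intro O A B f
      simp [assoc_hom, assoc_inv]))
    (fun M M' f => by
      ext
      simp [RightModule.eqToHom_hom, assoc_hom, assoc_inv])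
  naturality₂ a := by
    ext M; simp [eqToHom_app, RightModule.eqToHom_hom, assoc_hom, assoc_inv]

/-- The monad `S~` on `Mod_T(-)`, with multiplication `M m₀` and unit `M s₀`. -/
abbrev liftMonad : TransMonad (Mod T) where
  trans := d.liftTrans
  mul :=
    { app := fun k =>
        { app := fun M =>
            { hom := (α_ S.S₀.carrier S.S₀.carrier M.carrier).inv ≫ S.S₀.mul ▷ M.carrier
              comm := fun {O A B} f => by
                have e := congrArg M.act.app (d.twist_twist_mul f)
                rw [M.act.right_naturality, M.act.left_naturality] at e
                have e' := congrArg (fun x => A ◁ (α_ S.S₀.carrier S.S₀.carrier M.carrier).inv ≫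
                  (α_ A (S.S₀.carrier ≫ S.S₀.carrier) M.carrier).inv ≫
                  (α_ A S.S₀.carrier S.S₀.carrier).inv ▷ M.carrier ≫ x ≫
                  (α_ B S.S₀.carrier M.carrier).hom) e
                simp at e' ⊢
                exact e' }
          naturality := fun M M' f => by
            ext
            simp only [Functor.comp_map, RightModule.comp_hom, Category.assoc]
            rw [← whisker_exchange, ← associator_inv_naturality_right_assoc] }
      naturality := fun N => by
        ext M
        simp [eqToHom_app, RightModule.eqToHom_hom, assoc_hom, assoc_inv] }
  unit :=
    { app := fun k =>
        { app := fun M =>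
            { hom := (λ_ M.carrier).inv ≫ S.S₀.unit ▷ M.carrier
              comm := fun {O A B} f => by
                have e := congrArg M.act.app (d.twist_unit_monad f)
                rw [M.act.right_naturality, M.act.left_naturality] at e
                have e' := congrArg (fun x => x ≫ (α_ B S.S₀.carrier M.carrier).hom) e
                simp at e' ⊢
                exact e'.symm }
          naturality := fun M M' f => by
            ext
            simp only [Functor.id_map, RightModule.comp_hom, Category.assoc]
            rw [← whisker_exchange]
            simp }
      naturality := fun N => by
        ext M
        simp [eqToHom_app, RightModule.eqToHom_hom, assoc_hom, assoc_inv] }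
  assoc k M := by
    ext
    exact (preMonad S.S₀).assoc k M.carrier
  unit_left k M := by
    ext
    exact (preMonad S.S₀).unit_left k M.carrier
  unit_right k M := by
    ext
    exact (preMonad S.S₀).unit_right k M.carrier

/-- The modification `d* : U* (- ∘ S) ⟶ S~ U*` with components `M d : M S T ⟶ M T S₀`. -/
abbrev liftCell :
    Modif ((pre S.S.carrier).comp (freeTrans T)) ((freeTrans T).comp d.liftTrans) where
  app k :=
    { app := fun (M : X ⟶ k) =>
        { hom := (α_ T.carrier S.S.carrier M).inv ≫ d.d ▷ M ≫ (α_ S.S₀.carrier T.carrier M).hom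
          comm := fun {O A B} f => by
            have e := congrArg (fun x => (α_ A T.carrier (S.S.carrier ≫ M)).inv ≫
              (α_ (A ≫ T.carrier) S.S.carrier M).inv ≫ (α_ A T.carrier S.S.carrier).hom ▷ M ≫
              x ▷ M ≫ (α_ (B ≫ S.S₀.carrier) T.carrier M).hom ≫
              (α_ B S.S₀.carrier (T.carrier ≫ M)).hom) (d.D3 f)
            simp at e ⊢
            exact e }
      naturality := fun (M M' : X ⟶ k) f => by
        ext
        simp only [Functor.comp_map, RightModule.comp_hom, Category.assoc]
        rw [associator_inv_naturality_right_assoc, whisker_exchange_assoc, comp_whiskerLeft]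
        simp }
  naturality N := by
    ext M
    simp [eqToHom_app, RightModule.eqToHom_hom, assoc_hom, assoc_inv]

/-- The lifting of `S` to the relative right modules of `T` given by a relative distributive law. -/
def toLifting : Lifting T S where
  monad := d.liftMonad
  dstar := d.liftCell
  compatible :=
    { comm := rfl
      mul := fun k M => by simp
      unit := fun k M => by simp }
  morphism :=
    { unit := fun k (M : X ⟶ k) => by
        ext
        have e := congrArg (fun x => x ▷ M ≫ (α_ S.S₀.carrier T.carrier M).hom) d.D2
        simp at e ⊢
        exact e
      mul := fun k (M : X ⟶ k) => by
        ext
        have e := congrArg (fun x => T.carrier ◁ (α_ S.S.carrier S.S.carrier M).inv ≫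
          (α_ T.carrier (S.S.carrier ≫ S.S.carrier) M).inv ≫ x ▷ M ≫
          (α_ S.S₀.carrier T.carrier M).hom) d.D1
        simp at e ⊢
        exact e }
  transformation := by
    intro k (M : X ⟶ k)
    have e := congrArg (fun x => (α_ I S.S.carrier M).inv ≫ x ▷ M ≫
      (α_ S.S₀.carrier T.carrier M).hom) d.D4
    simp [compCell, Modif.ofEq] at e ⊢
    rw [e]
    simp [assoc_hom, assoc_inv]
  action := fun {k} M {O A B} f => by
    -- `f_{S~ T}` is `f'†`, so the required identity is `f'† · t S₀ A = f'`, with `(-)_m` applied.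
    have e := congrArg M.act.app (T.left_unit (twist T S d.d f))
    simp at e ⊢
    exact e.symm

end RelDistrLaw

/-! ### The relative distributive law of a lifting -/

namespace Lifting

variable [Bicategory.Strict K] {T : RelMonad I} {S : CompatibleMonad I} (L : Lifting T S)

/-- The equation `J* S~ = (- ∘ S₀) J*` on objects. -/
theorem carrier_eq {k : K} (M : RightModule T k) :
    ((L.monad.trans.app k).obj M).carrier = S.S₀.carrier ≫ M.carrier :=
  obj_of_comm L.compatible.comm k M

theorem map_hom {k : K} {M N : RightModule T k} (g : M ⟶ N) :
    ((L.monad.trans.app k).map g).hom =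
      eqToHom (L.carrier_eq M) ≫ S.S₀.carrier ◁ g.hom ≫ eqToHom (L.carrier_eq N).symm :=
  Functor.congr_hom (congrArg (fun α => Trans.app α k) L.compatible.comm) g

theorem mul_hom {k : K} (M : RightModule T k) :
    ((L.monad.mul.app k).app M).hom =
      eqToHom (by dsimp; rw [L.carrier_eq, L.carrier_eq]) ≫
        (α_ S.S₀.carrier S.S₀.carrier M.carrier).inv ≫ S.S₀.mul ▷ M.carrier ≫
        eqToHom (L.carrier_eq M).symm := by
  have h := congrArg (fun x => x ≫ eqToHom (L.carrier_eq M).symm) (L.compatible.mul k M)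
  simpa using h

theorem unit_hom {k : K} (M : RightModule T k) :
    ((L.monad.unit.app k).app M).hom =
      (λ_ M.carrier).inv ≫ S.S₀.unit ▷ M.carrier ≫ eqToHom (L.carrier_eq M).symm := by
  have h := congrArg (fun x => x ≫ eqToHom (L.carrier_eq M).symm) (L.compatible.unit k M)
  simpa using h

/-- The component `J* d*_M`, regarded as a 2-cell `M S T ⟶ M T S₀`. -/
def cell {k : K} (M : X ⟶ k) :
    T.carrier ≫ S.S.carrier ≫ M ⟶ S.S₀.carrier ≫ T.carrier ≫ M :=
  ((L.dstar.app k).app M).hom ≫ eqToHom (L.carrier_eq ((RightModule.self T).push M))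

theorem dstar_hom {k : K} (M : X ⟶ k) : ((L.dstar.app k).app M).hom =
    L.cell M ≫ eqToHom (L.carrier_eq ((RightModule.self T).push M)).symm := by
  simp [cell]

theorem cell_comp {k l : K} (M : X ⟶ k) (N : k ⟶ l) : L.cell (M ≫ N) =
    eqToHom (by simp only [Bicategory.Strict.assoc]) ≫ L.cell M ▷ N ≫
      eqToHom (by simp only [Bicategory.Strict.assoc]) := by
  have h := congrArg RightModule.Hom.hom (L.dstar.naturality_app N M)
  simp [RightModule.eqToHom_hom] at h
  simp [cell, h]

theorem cell_eq_of_eq {k : K} {M N : X ⟶ k} (h : M = N) :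
    L.cell M = eqToHom (by rw [h]) ≫ L.cell N ≫ eqToHom (by rw [h]) := by
  subst h; simp

/-- The 2-cell `d : S T ⟶ T S₀` of a lifting: the component of `d*` at the identity 1-cell. -/
def lawCell : T.carrier ≫ S.S.carrier ⟶ S.S₀.carrier ≫ T.carrier :=
  T.carrier ◁ (ρ_ S.S.carrier).inv ≫ L.cell (𝟙 X) ≫ S.S₀.carrier ◁ (ρ_ T.carrier).hom

/-- 2-naturality determines `d*` from its component at the identity: `J* d*_M = M d`. -/
theorem cell_eq {k : K} (M : X ⟶ k) : L.cell M =
    (α_ T.carrier S.S.carrier M).inv ≫ L.lawCell ▷ M ≫ (α_ S.S₀.carrier T.carrier M).hom := by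
  -- `M = M ∘ 1`, written `𝟙 X ≫ M`, so `d*_M` is `d*_1` followed by `M`.
  rw [L.cell_eq_of_eq (Bicategory.Strict.id_comp M).symm, cell_comp]
  simp [lawCell, assoc_hom, assoc_inv, Bicategory.Strict.rightUnitor_eqToIso]

/-- The structure operator of `S~ M`, with carrier regarded as `M S₀`. -/
def liftAct {k : K} (M : RightModule T k) {O : K} {A B : O ⟶ X₀} (f : A ≫ I ⟶ B ≫ T.carrier) :
    A ≫ S.S₀.carrier ≫ M.carrier ⟶ B ≫ S.S₀.carrier ≫ M.carrier :=
  A ◁ eqToHom (L.carrier_eq M).symm ≫ ((L.monad.trans.app k).obj M).act.app f ≫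
    B ◁ eqToHom (L.carrier_eq M)

theorem liftAct_eq_of_eq {k : K} {M N : RightModule T k} (h : M = N) {O : K} {A B : O ⟶ X₀}
    (f : A ≫ I ⟶ B ≫ T.carrier) :
    L.liftAct M f = A ◁ S.S₀.carrier ◁ eqToHom (congrArg RightModule.carrier h) ≫ L.liftAct N f ≫
      B ◁ S.S₀.carrier ◁ eqToHom (congrArg RightModule.carrier h).symm := by
  subst h; simp

/-- `d* : (M S T, M S (-)†) ⟶ S~ (M T, M (-)†)` is a module morphism. -/
theorem cell_comm {k : K} (M : X ⟶ k) {O : K} {A B : O ⟶ X₀} (f : A ≫ I ⟶ B ≫ T.carrier) :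
    ((α_ A T.carrier (S.S.carrier ≫ M)).inv ≫ T.ext.app f ▷ (S.S.carrier ≫ M) ≫
      (α_ B T.carrier (S.S.carrier ≫ M)).hom) ≫ B ◁ L.cell M =
    A ◁ L.cell M ≫ L.liftAct ((RightModule.self T).push M) f := by
  have h := congrArg (fun x => x ≫ B ◁ eqToHom (L.carrier_eq ((RightModule.self T).push M)))
    (((L.dstar.app k).app M).comm f)
  simp only [dstar_hom] at h
  simpa [liftAct] using h

theorem push_id_self : (RightModule.self T).push (𝟙 X) = RightModule.self T :=
  Functor.congr_obj ((Mod T).map_id X) (RightModule.self T)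

/-- `d B · S f† = f_{S~ T} · d A`: the module morphism property of `d*` at the identity 1-cell, with
`1 T` and `T` identified as modules. -/
theorem lawCell_comm {O : K} {A B : O ⟶ X₀} (f : A ≫ I ⟶ B ≫ T.carrier) :
    (α_ A T.carrier S.S.carrier).inv ≫ T.ext.app f ▷ S.S.carrier ≫
      (α_ B T.carrier S.S.carrier).hom ≫ B ◁ L.lawCell =
    A ◁ L.lawCell ≫ L.liftAct (RightModule.self T) f := by
  have h := L.cell_comm (𝟙 X) f
  rw [L.liftAct_eq_of_eq push_id_self] at h
  have h' := congrArg (fun x => A ◁ T.carrier ◁ (ρ_ S.S.carrier).inv ≫ x ≫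
    B ◁ S.S₀.carrier ◁ (ρ_ T.carrier).hom) h
  simp [lawCell, Bicategory.Strict.rightUnitor_eqToIso] at h' ⊢
  exact h'

/-- `d · S t = t S₀`. -/
theorem unit_lawCell : T.unit ▷ S.S.carrier ≫ L.lawCell =
    eqToHom S.comm ≫ S.S₀.carrier ◁ T.unit := by
  have h := L.transformation X (𝟙 X)
  simp [compCell, Modif.ofEq, eqToHom_app, dstar_hom, cell_eq] at h
  rw [← cancel_epi ((α_ I S.S.carrier (𝟙 X)).inv ≫ (ρ_ (I ≫ S.S.carrier)).hom),
    ← cancel_mono ((ρ_ (S.S₀.carrier ≫ T.carrier)).inv ≫ (α_ S.S₀.carrier T.carrier (𝟙 X)).hom)]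
  simp only [Category.assoc]
  rw [h]
  simp [assoc_hom, assoc_inv, Bicategory.Strict.rightUnitor_eqToIso]

/-- `d · m T = T m₀ · d S₀ · S d`. -/
theorem mul_lawCell : T.carrier ◁ S.S.mul ≫ L.lawCell =
    (α_ T.carrier S.S.carrier S.S.carrier).inv ≫ L.lawCell ▷ S.S.carrier ≫
      (α_ S.S₀.carrier T.carrier S.S.carrier).hom ≫ S.S₀.carrier ◁ L.lawCell ≫
      (α_ S.S₀.carrier S.S₀.carrier T.carrier).inv ≫ S.S₀.mul ▷ T.carrier := by
  have h := congrArg RightModule.Hom.hom (L.morphism.mul X (𝟙 X))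
  simp [map_hom, dstar_hom, mul_hom, cell_eq] at h
  rw [← cancel_epi (T.carrier ◁ (α_ S.S.carrier S.S.carrier (𝟙 X)).inv ≫
      (α_ T.carrier (S.S.carrier ≫ S.S.carrier) (𝟙 X)).inv ≫
        (ρ_ (T.carrier ≫ S.S.carrier ≫ S.S.carrier)).hom),
    ← cancel_mono ((ρ_ (S.S₀.carrier ≫ T.carrier)).inv ≫ (α_ S.S₀.carrier T.carrier (𝟙 X)).hom ≫
      eqToHom (L.carrier_eq ((RightModule.self T).push (𝟙 X))).symm)]
  simp only [Category.assoc]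
  rw [h]
  simp [assoc_hom, assoc_inv, Bicategory.Strict.rightUnitor_eqToIso]

/-- `d · s T = T s₀`. -/
theorem unit_monad_lawCell : (ρ_ T.carrier).inv ≫ T.carrier ◁ S.S.unit ≫ L.lawCell =
    (λ_ T.carrier).inv ≫ S.S₀.unit ▷ T.carrier := by
  have h := congrArg RightModule.Hom.hom (L.morphism.unit X (𝟙 X))
  simp [dstar_hom, unit_hom, cell_eq] at h
  rw [← cancel_mono ((ρ_ (S.S₀.carrier ≫ T.carrier)).inv ≫
      (α_ S.S₀.carrier T.carrier (𝟙 X)).hom ≫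
      eqToHom (L.carrier_eq ((RightModule.self T).push (𝟙 X))).symm)]
  simp only [Category.assoc]
  rw [h]
  simp [assoc_hom, assoc_inv, Bicategory.Strict.rightUnitor_eqToIso,
    Bicategory.Strict.leftUnitor_eqToIso]

/-- The composite `f_{S~ T} · t S₀ A` is `d B · S f`, since `d · S t = t S₀` and `d` is a module
morphism. -/
theorem unit_liftAct {O : K} {A B : O ⟶ X₀} (f : A ≫ I ⟶ B ≫ T.carrier) :
    (α_ A S.S₀.carrier I).hom ≫ A ◁ S.S₀.carrier ◁ T.unit ≫ L.liftAct (RightModule.self T) f ≫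
      (α_ B S.S₀.carrier T.carrier).inv = twist T S L.lawCell f := by
  have h : S.S₀.carrier ◁ T.unit = eqToHom S.comm.symm ≫ T.unit ▷ S.S.carrier ≫ L.lawCell := by
    simp [unit_lawCell]
  rw [h]
  simp only [whiskerLeft_comp, Category.assoc]
  rw [← reassoc_of% L.lawCell_comm f]
  have h' := congrArg (fun x => x ▷ S.S.carrier) (T.left_unit f)
  simp only [comp_whiskerRight, whisker_assoc, Category.assoc] at h'
  rw [twist, ← h']
  simp

/-- The structure operator of a lifted module is determined by the law:
`f_{S~ m} = (d B · S f)_m`. -/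
theorem act_eq {k : K} (M : RightModule T k) {O : K} {A B : O ⟶ X₀}
    (f : A ≫ I ⟶ B ≫ T.carrier) :
    ((L.monad.trans.app k).obj M).act.app f =
      A ◁ eqToHom (L.carrier_eq M) ≫ (α_ A S.S₀.carrier M.carrier).inv ≫
        M.act.app (twist T S L.lawCell f) ≫ (α_ B S.S₀.carrier M.carrier).hom ≫
        B ◁ eqToHom (L.carrier_eq M).symm := by
  rw [L.action M f, ← unit_liftAct]
  simp only [liftAct, Category.assoc]

/-- The relative distributive law of a lifting. -/
def toLaw : RelDistrLaw T S where
  d := L.lawCell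
  D1 := L.mul_lawCell
  D2 := L.unit_monad_lawCell
  D3 f := by
    -- the formula for the structure operator of `S~ M`, at `M = T`
    have h : L.liftAct (RightModule.self T) f = (α_ _ S.S₀.carrier T.carrier).inv ≫
        T.ext.app (twist T S L.lawCell f) ≫ (α_ _ S.S₀.carrier T.carrier).hom := by
      rw [liftAct, act_eq]
      simp
    have h' := L.lawCell_comm f
    rw [h] at h'
    rw [← cancel_mono (α_ _ S.S₀.carrier T.carrier).hom]
    simpa using h'
  D4 := L.unit_lawCell

end Lifting

/-! ### Liftings are determined by their law -/

/-- Extensionality for monads on a 2-functor, with components compared up to the identity morphisms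
between the values of equal transformations. -/
theorem TransMonad.ext_of_eqToHom {F : CatFunctor.{w, v, u, w₁, v₁} K} {P Q : TransMonad F}
    (h : P.trans = Q.trans)
    (hm : ∀ (k : K) (M : F.obj k), (P.mul.app k).app M = eqToHom (by rw [h]) ≫
      (Q.mul.app k).app M ≫ eqToHom (by rw [h]))
    (hu : ∀ (k : K) (M : F.obj k), (P.unit.app k).app M = (Q.unit.app k).app M ≫
      eqToHom (by rw [h])) : P = Q := by
  obtain ⟨p, m, s, _, _, _⟩ := P
  obtain ⟨q, m', s', _, _, _⟩ := Q
  obtain rfl : p = q := h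
  obtain rfl : m = m' := by
    ext k M
    simpa using hm k M
  obtain rfl : s = s' := by
    ext k M
    simpa using hu k M
  rfl

variable [Bicategory.Strict K] {T : RelMonad I} {S : CompatibleMonad I}

namespace Lifting

variable {L L' : Lifting T S}

theorem trans_eq_of_lawCell_eq (h : L.lawCell = L'.lawCell) : L.monad.trans = L'.monad.trans := by
  apply Trans.ext
  funext k
  refine CategoryTheory.Functor.ext (fun M => RightModule.ext_of_eqToHom
    ((L.carrier_eq M).trans (L'.carrier_eq M).symm) ?_) ?_
  · intro O A B f
    simp [act_eq, h]
  · intro M N g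
    ext
    simp [map_hom, RightModule.eqToHom_hom]

/-- A lifting is determined by its 2-cell `d`: carriers, `m~` and `s~` are prescribed by `J*`, the
operators are `(d B · S (-))_m`, and `d*_M` is `M d`. -/
theorem eq_of_lawCell_eq (h : L.lawCell = L'.lawCell) : L = L' := by
  have hm : L.monad = L'.monad := by
    refine TransMonad.ext_of_eqToHom (trans_eq_of_lawCell_eq h) (fun k M => ?_) (fun k M => ?_)
    · ext
      simp [mul_hom, RightModule.eqToHom_hom]
    · ext
      simp [unit_hom, RightModule.eqToHom_hom]
  have hd : ∀ {k : K} (M : X ⟶ k), ((L.dstar.app k).app M).hom =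
      ((L'.dstar.app k).app M).hom ≫ eqToHom (by rw [hm]) := by
    intro k M
    rw [dstar_hom, dstar_hom, cell_eq, cell_eq, h]
    simp
  obtain ⟨m, δ, _, _, _, _⟩ := L
  obtain ⟨m', δ', _, _, _, _⟩ := L'
  obtain rfl : m = m' := hm
  obtain rfl : δ = δ' := by
    apply Modif.ext
    funext k
    ext M
    simpa using hd M
  rfl

end Lifting

theorem RelDistrLaw.lawCell_toLifting (d : RelDistrLaw T S) : d.toLifting.lawCell = d.d := by
  simp [Lifting.lawCell, Lifting.cell, RelDistrLaw.toLifting]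

/-- Relative distributive laws are equivalent to liftings. -/
def lawEquivLifting (T : RelMonad I) (S : CompatibleMonad I) :
    RelDistrLaw T S ≃ Lifting T S where
  toFun d := d.toLifting
  invFun L := L.toLaw
  left_inv := fun d => RelDistrLaw.ext (by exact d.lawCell_toLifting)
  right_inv := fun L => Lifting.eq_of_lawCell_eq (by exact L.toLaw.lawCell_toLifting)

end RelMnd

theorem mainTheorem3 {K : Type u} [Bicategory.{w, v} K] [Bicategory.Strict K]
    {X₀ X : K} {I : X₀ ⟶ X} (T : RelMnd.RelMonad I) (S : RelMnd.CompatibleMonad I) :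
    ∃ e : RelMnd.RelDistrLaw T S ≃ RelMnd.Lifting T S, ∀ d : RelMnd.RelDistrLaw T S,
      (∀ {k : K} (M : X ⟶ k),
        (((e d).dstar.app k).app M).hom =
          (α_ T.carrier S.S.carrier M).inv ≫ d.d ▷ M ≫ (α_ S.S₀.carrier T.carrier M).hom ≫
            eqToHom (RelMnd.obj_of_comm (e d).compatible.comm k
              ((RelMnd.RightModule.self T).push M)).symm) ∧
      (∀ {k : K} (M : RelMnd.RightModule T k) {O : K} {A B : O ⟶ X₀}
        (f : A ≫ I ⟶ B ≫ T.carrier),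
        (((e d).monad.trans.app k).obj M).act.app f =
          A ◁ eqToHom (RelMnd.obj_of_comm (e d).compatible.comm k M) ≫
            (α_ A S.S₀.carrier M.carrier).inv ≫ M.act.app (RelMnd.twist T S d.d f) ≫
            (α_ B S.S₀.carrier M.carrier).hom ≫
            B ◁ eqToHom (RelMnd.obj_of_comm (e d).compatible.comm k M).symm) := by
  refine ⟨RelMnd.lawEquivLifting T S, fun d => ⟨fun {k} M => ?_, fun {k} M {O A B} f => ?_⟩⟩
  · have h := d.toLifting.dstar_hom M
    rw [RelMnd.Lifting.cell_eq, d.lawCell_toLifting] at h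
    simp only [Category.assoc] at h
    exact h
  · have h := d.toLifting.act_eq M f
    rw [d.lawCell_toLifting] at h
    exact h
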